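/- **Setting.** Let $M=(\mathcal S,\mathcal A,P,R,\gamma,d_0)$ be a discounted MDP with finite state and action spaces, deterministic rewards $R:\mathcal S\times\mathcal A\to[0,R_{\max}]$, discount factor $\gamma\in[0,1)$ and initial state distribution $d_0$; put $V_{\max}=R_{\max}/(1-\gamma)$. Policies may be nonstationary and stochastic; $d_t^\pi$ is the law of $(s_t,a_t)$ when $\pi$ is run from $s_0\sim d_0$, and $J(\pi)=\sum_{t\ge0}\gamma^t\,\mathbb E_{(s,a)\sim d_t^\pi}[R(s,a)]$. $Q^\star$ is the unique fixed point of the Bellman optimality operator $(\mathcal Tf)(s,a)=R(s,a)+\gamma\,\mathbb E_{s'\sim P(\cdot|s,a)}[\max_{a'}f(s',a')]$. A batch learner receives $n$ i.i.d. tuples $(s,a,r,s')$ with $(s,a)\sim\mu$, $r=R(s,a)$, $s'\sim P(\cdot|s,a)$, where $\mu(s,a)>0$ for all $(s,a)$, and outputs a policy by a possibly randomized measurable rule; it may depend on $\mathcal S,\mathcal A,\gamma,R_{\max},n$, a given function class $\mathcal F\subset(\mathcal S\times\mathcal A\to[0,V_{\max}])$ and all other constants below, but knows $M$ and $\mu$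 only through the data. *$\mathcal F$-aware concentrability with constant $C$*: for all $f,f'\in\mathcal F$, all policies $\pi$ and all $t\ge0$, $\|f-f'\|_{2,d_t^\pi}^2\le C\,\|f-f'\|_{2,\mu}^2$, where $\|g\|_{2,\nu}^2=\mathbb E_\nu[g^2]$. **Proposition.** Under realizability ($Q^\star\in\mathcal F$) and $\mathcal F$-aware concentrability, no algorithm has finite sample complexity. Precisely: for every $\gamma\in(0,1)$ and $R_{\max}>0$ there are finite nonempty sets $\mathcal S,\mathcal A$, a finite class $\mathcal F\subset(\mathcal S\times\mathcal A\to[0,V_{\max}])$ and constants $C,\varepsilon>0$ such that for every $\delta\in(0,1/2)$ and every $n\in\mathbb N$ there is no batch learner using $n$ tuples that, for all MDPs $M$ on $\mathcal S,\mathcal A$ with discount factor $\gamma$ and rewards in $[0,R_{\max}]$ and all $\mu$ with full support such that $Q^\star\in\mathcal F$ and $\mathcal F$-aware concentrability with constant $C$ holds, outputs with probability at least $1-\delta$ a policy $\hat\pi$ with $\max_\pi J(\pi)-J(\hat\pi)\le\varepsilon V_{\max}$. -/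

import Mathlib

open MeasureTheory ProbabilityTheory
open scoped NNReal ENNReal

namespace BatchRL

noncomputable section

/-- A discounted MDP with finite state space `S`, finite action space `A`, discount factor
`γ ∈ [0, 1)`, transition probabilities `P`, deterministic rewards `R` with values in
`[0, Rmax]`, and initial state distribution `d0`. -/
structure MDP (S A : Type) [Fintype S] (γ Rmax : ℝ) where
  P : S × A → stdSimplex ℝ S
  R : S × A → ℝ
  d0 : stdSimplex ℝ S
  gamma_nonneg : 0 ≤ γ
  gamma_lt_one : γ < 1
  R_nonneg : ∀ x, 0 ≤ R x
  R_le : ∀ x, R x ≤ Rmax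

/-- A possibly nonstationary, possibly stochastic policy: `π t s` is the distribution of the
action taken in state `s` at time `t`. -/
abbrev Policy (S A : Type) [Fintype A] : Type := ℕ → S → stdSimplex ℝ A

/-- A data tuple `((s, a), r, s')`. -/
abbrev Tuple (S A : Type) : Type := (S × A) × ℝ × S

/-- `V_max = R_max / (1 - γ)`. -/
def Vmax (γ Rmax : ℝ) : ℝ := Rmax / (1 - γ)

/-- The squared weighted norm `‖f‖²_{2,ν} = ∑ ν(s,a) f(s,a)²`. -/
def sqNorm {X : Type} [Fintype X] (ν : X → ℝ) (f : X → ℝ) : ℝ := ∑ x, ν x * f x ^ 2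

namespace MDP

variable {S A : Type} [Fintype S] [Fintype A] {γ Rmax : ℝ}

/-- The law of the state `s_t` when `π` is run from `s_0 ∼ d0`. -/
def stateDist (M : MDP S A γ Rmax) (π : Policy S A) : ℕ → S → ℝ
  | 0 => fun s => M.d0 s
  | t + 1 => fun s' => ∑ s, ∑ a, M.stateDist π t s * π t s a * M.P (s, a) s'

/-- The law `d_t^π` of the state-action pair `(s_t, a_t)` when `π` is run from `s_0 ∼ d0`. -/
def occ (M : MDP S A γ Rmax) (π : Policy S A) (t : ℕ) (x : S × A) : ℝ :=
  M.stateDist π t x.1 * π t x.1 x.2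

/-- The expected discounted return `J(π) = ∑ₜ γᵗ 𝔼[R(s_t, a_t)]`. -/
def J (M : MDP S A γ Rmax) (π : Policy S A) : ℝ :=
  ∑' t : ℕ, γ ^ t * ∑ x, M.occ π t x * M.R x

/-- The Bellman optimality operator
`(𝒯 f)(s,a) = R(s,a) + γ 𝔼_{s' ∼ P(s,a)}[max_{a'} f(s',a')]`. -/
def bellman (M : MDP S A γ Rmax) (f : S × A → ℝ) (x : S × A) : ℝ :=
  M.R x + γ * ∑ s', M.P x s' * ⨆ a', f (s', a')

theorem bellman_contracting [Nonempty A] (M : MDP S A γ Rmax) :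
    ContractingWith ⟨γ, M.gamma_nonneg⟩ M.bellman := by
  refine ⟨?_, LipschitzWith.of_dist_le_mul fun f g => ?_⟩
  · exact M.gamma_lt_one
  · have key : ∀ (f g : S × A → ℝ) (s : S), (⨆ a, f (s, a)) ≤ (⨆ a, g (s, a)) + dist f g := by
      intro f g s
      refine ciSup_le fun a => ?_
      have h1 : f (s, a) - g (s, a) ≤ dist f g :=
        (le_abs_self _).trans (dist_le_pi_dist f g (s, a))
      have h2 : g (s, a) ≤ ⨆ a, g (s, a) :=
        le_ciSup (f := fun a => g (s, a)) (Set.finite_range _).bddAbove a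
      linarith
    have hγ := M.gamma_nonneg
    refine (dist_pi_le_iff (mul_nonneg hγ dist_nonneg)).2 fun x => ?_
    have hsum : ∑ s', M.P x s' = 1 := (M.P x).2.2
    have hb : ∀ (f g : S × A → ℝ),
        (∑ s', M.P x s' * ⨆ a', f (s', a')) - (∑ s', M.P x s' * ⨆ a', g (s', a')) ≤ dist f g := by
      intro f g
      have h : (∑ s', M.P x s' * ⨆ a', f (s', a'))
          ≤ ∑ s', (M.P x s' * (⨆ a', g (s', a')) + M.P x s' * dist f g) :=
        Finset.sum_le_sum fun s' _ => by
          rw [← mul_add]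
          exact mul_le_mul_of_nonneg_left (key f g s') ((M.P x).2.1 s')
      rw [Finset.sum_add_distrib, ← Finset.sum_mul, hsum] at h
      linarith
    have h1 := mul_le_mul_of_nonneg_left (hb f g) hγ
    have h2 := mul_le_mul_of_nonneg_left (hb g f) hγ
    rw [dist_comm g f] at h2
    rw [Real.dist_eq, abs_le]
    simp only [bellman]
    constructor <;> linarith

/-- The optimal value function `Q⋆`, the unique fixed point of the Bellman optimality operator. -/
def Qstar [Nonempty A] (M : MDP S A γ Rmax) : S × A → ℝ :=
  M.bellman_contracting.fixedPoint

/-- `π` is near-optimal with accuracy `ε V_max`: no policy has a return larger than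
`J(π) + ε V_max`. -/
def NearOptimal (M : MDP S A γ Rmax) (ε : ℝ) (π : Policy S A) : Prop :=
  ∀ π' : Policy S A, M.J π' - M.J π ≤ ε * Vmax γ Rmax

/-- The law of a data tuple: `(s,a) ∼ μ`, `r = R(s,a)`, `s' ∼ P(s,a)`. -/
def tupleLaw [MeasurableSpace S] [MeasurableSpace A]
    (M : MDP S A γ Rmax) (μ : stdSimplex ℝ (S × A)) : Measure (Tuple S A) :=
  ∑ x, ∑ s', ENNReal.ofReal (μ x * M.P x s') • Measure.dirac (x, M.R x, s')

instance [MeasurableSpace S] [MeasurableSpace A]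
    (M : MDP S A γ Rmax) (μ : stdSimplex ℝ (S × A)) : IsProbabilityMeasure (M.tupleLaw μ) := by
  have hP : ∀ x, ∑ s', M.P x s' = 1 := fun x => (M.P x).2.2
  have hμ : ∑ x, μ x = 1 := μ.2.2
  have hnn : ∀ x s', 0 ≤ μ x * M.P x s' := fun x s' => mul_nonneg (μ.2.1 x) ((M.P x).2.1 s')
  constructor
  simp only [tupleLaw, Measure.coe_finsetSum, Finset.sum_apply, Measure.smul_apply, measure_univ,
    smul_eq_mul, mul_one]
  rw [Finset.sum_congr rfl fun x _ =>
      (ENNReal.ofReal_sum_of_nonneg fun s' _ => hnn x s').symm,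
    ← ENNReal.ofReal_sum_of_nonneg fun x _ => Finset.sum_nonneg fun s' _ => hnn x s']
  simp [← Finset.mul_sum, hP, hμ]

/-- The law of a dataset of `n` independent data tuples. -/
def dataLaw [MeasurableSpace S] [MeasurableSpace A]
    (M : MDP S A γ Rmax) (μ : stdSimplex ℝ (S × A)) (n : ℕ) : Measure (Fin n → Tuple S A) :=
  Measure.pi fun _ => M.tupleLaw μ

/-- `F`-aware concentrability with constant `C`. -/
def FAwareConc (M : MDP S A γ Rmax) (μ : stdSimplex ℝ (S × A)) (F : Set (S × A → ℝ))
    (C : ℝ) : Prop :=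
  ∀ f ∈ F, ∀ f' ∈ F, ∀ (π : Policy S A) (t : ℕ),
    sqNorm (M.occ π t) (f - f') ≤ C * sqNorm (fun x => μ x) (f - f')

end MDP

/-- A batch learning algorithm using `n` data tuples: a (possibly randomized) measurable rule that
turns a dataset into a policy. -/
structure Learner (S A : Type) [Fintype A] [MeasurableSpace S] [MeasurableSpace A] (n : ℕ) where
  rule : Kernel (Fin n → Tuple S A) (Policy S A)
  isMarkov : IsMarkovKernel rule

/-- `L` succeeds with accuracy `ε V_max` and confidence `1 - δ` on every MDP `M` (with discount
factor `γ` and rewards in `[0, Rmax]`) and every fully supported data distribution `μ` such that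
`Q⋆ ∈ F` and `F`-aware concentrability holds with constant `C`. -/
def Learner.Succeeds {S A : Type} [Fintype S] [Fintype A] [Nonempty A] [MeasurableSpace S]
    [MeasurableSpace A] {n : ℕ} (L : Learner S A n) (γ Rmax : ℝ) (F : Set (S × A → ℝ))
    (C ε δ : ℝ) : Prop :=
  ∀ (M : MDP S A γ Rmax) (μ : stdSimplex ℝ (S × A)),
    (∀ x, 0 < μ x) → M.Qstar ∈ F → M.FAwareConc μ F C →
      ENNReal.ofReal (1 - δ) ≤ (M.dataLaw μ n).bind L.rule {π | M.NearOptimal ε π}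

end

end BatchRL

/-!
The lower bound is a two-point argument on a one-step choice problem. From the initial state `0` the
action `a` leads to the absorbing state `a + 1`. In the MDP with index `b` the absorbing state
`b + 1` pays `Rmax` in every step and the other one pays nothing, so a policy earns `γ Vmax` times
the probability `p` with which it first chooses `b`; accuracy `γ/4` forces `p ≥ 3/4`, which cannot
hold for both values of `b` (`half_lt_of_nearOptimal`).

The class `F` consists of the two optimal value functions. They differ by `γ Vmax` at the initial
state and by `Vmax` elsewhere, so a data distribution that puts at least half of its mass on the
initial state satisfies `F`-aware concentrability with constant `2 / γ²`, however little mass it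
puts on the absorbing states (`choiceMDP_fAwareConc`). Data from the initial state have the same law
in both MDPs (`restrict_tupleLaw_eq`), and once the mass on the absorbing states is small
compared with `1 / n`, a dataset most likely contains nothing else (`dataLaw_compl_initialData_le`).
A learner therefore succeeds on the two MDPs with probabilities whose sum exceeds one by an
arbitrarily small amount (`bind_add_bind_le`), against the required `2 (1 - δ) > 1`.
-/

namespace BatchRL

open MDP

noncomputable section

/-! ### The two-point inequality -/

/-- Le Cam's two-point bound: if two data laws agree on the event `E`, then the success
probabilities of a randomized rule for two incompatible goals add up to at most one, up to the
probabilities of `Eᶜ`. The goals need not be measurable, only separated by a measurable set. -/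
theorem bind_add_bind_le {X Y : Type*} [MeasurableSpace X] [MeasurableSpace Y]
    (D D' : Measure X) [IsProbabilityMeasure D] [IsProbabilityMeasure D']
    (κ : Kernel X Y) [IsMarkovKernel κ]
    {E : Set X} (hE : MeasurableSet E) (hDD' : D.restrict E = D'.restrict E)
    {G G' B : Set Y} (hB : MeasurableSet B) (hG : G ⊆ B) (hG' : G' ⊆ Bᶜ) :
    D.bind κ G + D'.bind κ G' ≤ 1 + (D Eᶜ + D' Eᶜ) := by
  have bound : ∀ (ν : Measure X) (T : Set Y), MeasurableSet T →
      ν.bind κ T ≤ (∫⁻ x in E, κ x T ∂ν) + ν Eᶜ := by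
    intro ν T hT
    rw [Measure.bind_apply hT κ.measurable.aemeasurable, ← lintegral_add_compl _ hE]
    gcongr
    calc ∫⁻ x in Eᶜ, κ x T ∂ν ≤ ∫⁻ _ in Eᶜ, 1 ∂ν := lintegral_mono fun x => prob_le_one
      _ = ν Eᶜ := by simp
  calc D.bind κ G + D'.bind κ G'
      ≤ D.bind κ B + D'.bind κ Bᶜ := add_le_add (measure_mono hG) (measure_mono hG')
    _ ≤ ((∫⁻ x in E, κ x B ∂D) + D Eᶜ) + ((∫⁻ x in E, κ x Bᶜ ∂D) + D' Eᶜ) := by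
        refine add_le_add (bound D B hB) ?_
        rw [hDD']
        exact bound D' Bᶜ hB.compl
    _ = (∫⁻ x in E, (κ x B + κ x Bᶜ) ∂D) + (D Eᶜ + D' Eᶜ) := by
        rw [lintegral_add_left (κ.measurable_coe hB)]
        ring
    _ ≤ 1 + (D Eᶜ + D' Eᶜ) := by
        gcongr
        calc ∫⁻ x in E, (κ x B + κ x Bᶜ) ∂D = D E := by simp [prob_add_prob_compl hB]
          _ ≤ 1 := prob_le_one

/-! ### The choice problem -/

variable {γ Rmax : ℝ}

/-- The MDP with states `0, 1, 2` in which the action `a` moves from the initial state `0` to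
`a + 1`, the states `1` and `2` are absorbing, and only the state `b + 1` pays, namely `Rmax` in
every step. -/
def choiceMDP (hγ0 : 0 < γ) (hγ1 : γ < 1) (hR : 0 < Rmax) (b : Fin 2) :
    MDP (Fin 3) (Fin 2) γ Rmax where
  P x := stdSimplex.vertex (if x.1 = 0 then x.2.succ else x.1)
  R x := if x.1 = b.succ then Rmax else 0
  d0 := stdSimplex.vertex 0
  gamma_nonneg := hγ0.le
  gamma_lt_one := hγ1
  R_nonneg x := by split_ifs <;> linarith
  R_le x := by split_ifs <;> linarith

/-- The optimal value function of `choiceMDP` with index `b`. -/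
def choiceQ (γ Rmax : ℝ) (b : Fin 2) (x : Fin 3 × Fin 2) : ℝ :=
  if x.1 = 0 then (if x.2 = b then γ * Vmax γ Rmax else 0)
  else if x.1 = b.succ then Vmax γ Rmax else 0

theorem Vmax_pos (hγ1 : γ < 1) (hR : 0 < Rmax) : 0 < Vmax γ Rmax :=
  div_pos hR (by linarith)

theorem choiceQ_mem_Icc (hγ0 : 0 < γ) (hγ1 : γ < 1) (hR : 0 < Rmax) (b : Fin 2)
    (x : Fin 3 × Fin 2) : 0 ≤ choiceQ γ Rmax b x ∧ choiceQ γ Rmax b x ≤ Vmax γ Rmax := by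
  have hV := Vmax_pos hγ1 hR
  have h1 : 0 ≤ γ * Vmax γ Rmax := by positivity
  have h2 : γ * Vmax γ Rmax ≤ Vmax γ Rmax := by nlinarith
  unfold choiceQ
  split_ifs <;> constructor <;> linarith

theorem vertex_apply {X : Type*} [Fintype X] [DecidableEq X] (x y : X) :
    (stdSimplex.vertex x : stdSimplex ℝ X) y = if y = x then 1 else 0 :=
  Pi.single_apply x 1 y

theorem Qstar_choiceMDP (hγ0 : 0 < γ) (hγ1 : γ < 1) (hR : 0 < Rmax) (b : Fin 2) :
    (choiceMDP hγ0 hγ1 hR b).Qstar = choiceQ γ Rmax b := by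
  have hV : Rmax + γ * Vmax γ Rmax = Vmax γ Rmax := by
    have : 1 - γ ≠ 0 := by linarith
    unfold Vmax
    field_simp
    ring
  refine ((choiceMDP hγ0 hγ1 hR b).bellman_contracting.fixedPoint_unique ?_).symm
  funext ⟨s, a⟩
  by_cases hs : s = 0
  · subst hs
    simp [bellman, choiceMDP, vertex_apply, choiceQ, (Fin.succ_ne_zero _).symm]
  · simp only [bellman, choiceMDP, vertex_apply, hs, if_false, ite_mul, one_mul, zero_mul,
      Finset.sum_ite_eq', Finset.mem_univ, if_true, choiceQ]
    split_ifs <;> simp [hV]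

/-! ### Returns in the choice problem -/

theorem stateDist_choiceMDP_zero (hγ0 : 0 < γ) (hγ1 : γ < 1) (hR : 0 < Rmax) (b : Fin 2)
    (π : Policy (Fin 3) (Fin 2)) (t : ℕ) :
    (choiceMDP hγ0 hγ1 hR b).stateDist π (t + 1) 0 = 0 := by
  have hP : ∀ x, (choiceMDP hγ0 hγ1 hR b).P x 0 = 0 := by
    intro x
    by_cases hx : x.1 = 0
    · simp [choiceMDP, vertex_apply, hx, (Fin.succ_ne_zero _).symm]
    · simp [choiceMDP, vertex_apply, hx, Ne.symm hx]
  simp [stateDist, hP]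

theorem stateDist_choiceMDP_step (hγ0 : 0 < γ) (hγ1 : γ < 1) (hR : 0 < Rmax) (b c : Fin 2)
    (π : Policy (Fin 3) (Fin 2)) (t : ℕ) :
    (choiceMDP hγ0 hγ1 hR b).stateDist π (t + 1) c.succ =
      (choiceMDP hγ0 hγ1 hR b).stateDist π t 0 * π t 0 c +
        (choiceMDP hγ0 hγ1 hR b).stateDist π t c.succ := by
  set M := choiceMDP hγ0 hγ1 hR b with hM
  have hP : ∀ s a, M.P (s, a) c.succ =
      if (if s = 0 then a.succ else s) = c.succ then 1 else 0 := by
    intro s a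
    simp only [hM, choiceMDP, vertex_apply, eq_comm]
  have hstay : ∀ s, M.stateDist π t s * π t s 0 + M.stateDist π t s * π t s 1 =
      M.stateDist π t s := by
    intro s
    rw [← mul_add, stdSimplex.add_eq_one, mul_one]
  simp only [stateDist, hP]
  fin_cases c <;> simp [Fin.sum_univ_succ, hstay]

/-- From time `1` on, the state records the first action. -/
theorem stateDist_choiceMDP_succ (hγ0 : 0 < γ) (hγ1 : γ < 1) (hR : 0 < Rmax) (b c : Fin 2)
    (π : Policy (Fin 3) (Fin 2)) (t : ℕ) :
    (choiceMDP hγ0 hγ1 hR b).stateDist π (t + 1) c.succ = π 0 0 c := by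
  induction t with
  | zero =>
    rw [stateDist_choiceMDP_step]
    simp [stateDist, choiceMDP, vertex_apply]
  | succ t ih => rw [stateDist_choiceMDP_step, stateDist_choiceMDP_zero, ih, zero_mul, zero_add]

/-- The return is linear in the probability of first choosing `b`: the reward `Rmax` is collected
with this probability in every step from time `1` on, which sums to `γ / (1 - γ) * Rmax`. -/
theorem J_choiceMDP (hγ0 : 0 < γ) (hγ1 : γ < 1) (hR : 0 < Rmax) (b : Fin 2)
    (π : Policy (Fin 3) (Fin 2)) :
    (choiceMDP hγ0 hγ1 hR b).J π = γ * Vmax γ Rmax * π 0 0 b := by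
  set M := choiceMDP hγ0 hγ1 hR b with hM
  have hstep : ∀ t, ∑ x, M.occ π t x * M.R x = M.stateDist π t b.succ * Rmax := by
    intro t
    rw [Fintype.sum_prod_type, Finset.sum_eq_single b.succ]
    · simp only [hM, choiceMDP, occ, if_true]
      rw [← Finset.sum_mul, ← Finset.mul_sum, stdSimplex.sum_eq_one, mul_one]
    · intro s _ hs
      simp [hM, choiceMDP, hs]
    · simp
  have h0 : M.stateDist π 0 b.succ = 0 := by
    simp [hM, stateDist, choiceMDP, vertex_apply]
  have hterm : ∀ t, γ ^ (t + 1) * (M.stateDist π (t + 1) b.succ * Rmax) =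
      γ ^ t * (γ * Rmax * π 0 0 b) := by
    intro t
    rw [stateDist_choiceMDP_succ]
    ring
  have hgeo := (hasSum_geometric_of_lt_one hγ0.le hγ1).mul_right (γ * Rmax * π 0 0 b)
  have hs : HasSum (fun t => γ ^ t * (M.stateDist π t b.succ * Rmax))
      ((1 - γ)⁻¹ * (γ * Rmax * π 0 0 b)) := by
    rw [← hasSum_nat_add_iff' 1]
    simpa [h0, hterm] using hgeo
  simp only [J, hstep]
  rw [hs.tsum_eq, Vmax]
  ring

/-- Near-optimal policies favour the rewarded action at the start. -/
theorem half_lt_of_nearOptimal (hγ0 : 0 < γ) (hγ1 : γ < 1) (hR : 0 < Rmax) {b : Fin 2}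
    {π : Policy (Fin 3) (Fin 2)} (h : (choiceMDP hγ0 hγ1 hR b).NearOptimal (γ / 4) π) :
    1 / 2 < π 0 0 b := by
  have h' := h fun _ _ => stdSimplex.vertex b
  rw [J_choiceMDP, J_choiceMDP, vertex_apply, if_pos rfl] at h'
  have hpos : 0 < γ * Vmax γ Rmax := mul_pos hγ0 (Vmax_pos hγ1 hR)
  nlinarith

/-! ### The data distribution -/

/-- The data distribution with mass `η` on each state-action pair outside the initial state, and
the remaining mass shared equally between the two actions at the initial state. -/
def rareDist (η : ℝ) (h0 : 0 < η) (h1 : η ≤ 1 / 8) : stdSimplex ℝ (Fin 3 × Fin 2) :=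
  ⟨fun x => if x.1 = 0 then (1 - 4 * η) / 2 else η, by
    refine ⟨fun x => ?_, ?_⟩
    · dsimp only
      split_ifs <;> linarith
    · simp [Fintype.sum_prod_type, Fin.sum_univ_succ]
      ring⟩

theorem rareDist_apply (η : ℝ) (h0 : 0 < η) (h1 : η ≤ 1 / 8) (x : Fin 3 × Fin 2) :
    rareDist η h0 h1 x = if x.1 = 0 then (1 - 4 * η) / 2 else η := rfl

theorem occ_nonneg {S A : Type} [Fintype S] [Fintype A] (M : MDP S A γ Rmax)
    (π : Policy S A) (t : ℕ) (x : S × A) : 0 ≤ M.occ π t x := by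
  have h : ∀ t s, 0 ≤ M.stateDist π t s := by
    intro t
    induction t with
    | zero => exact fun s => stdSimplex.zero_le M.d0 s
    | succ t ih =>
      exact fun s' => Finset.sum_nonneg fun s _ => Finset.sum_nonneg fun a _ =>
        mul_nonneg (mul_nonneg (ih s) ((π t s).2.1 a)) ((M.P (s, a)).2.1 s')
  exact mul_nonneg (h t x.1) ((π t x.1).2.1 x.2)

theorem sum_occ {S A : Type} [Fintype S] [Fintype A] (M : MDP S A γ Rmax)
    (π : Policy S A) (t : ℕ) : ∑ x, M.occ π t x = 1 := by
  have h : ∀ t, ∑ s, M.stateDist π t s = 1 := by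
    intro t
    induction t with
    | zero => exact stdSimplex.sum_eq_one M.d0
    | succ t ih =>
      calc ∑ s', M.stateDist π (t + 1) s'
          = ∑ s, ∑ a, ∑ s', M.stateDist π t s * π t s a * M.P (s, a) s' := by
            simp only [stateDist]
            rw [Finset.sum_comm]
            exact Finset.sum_congr rfl fun s _ => Finset.sum_comm
        _ = 1 := by simpa [← Finset.mul_sum] using ih
  simpa [Fintype.sum_prod_type, occ, ← Finset.mul_sum] using h t

/-- The optimal value functions of the two problems differ at the initial state, which carries at
least half of the data, by no less than `γ` times their largest difference. -/
theorem choiceMDP_fAwareConc (hγ0 : 0 < γ) (hγ1 : γ < 1) (hR : 0 < Rmax) (b : Fin 2)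
    (η : ℝ) (h0 : 0 < η) (h1 : η ≤ 1 / 8) :
    (choiceMDP hγ0 hγ1 hR b).FAwareConc (rareDist η h0 h1)
      (Set.range (choiceQ γ Rmax)) (2 / γ ^ 2) := by
  rintro _ ⟨c, rfl⟩ _ ⟨c', rfl⟩ π t
  set M := choiceMDP hγ0 hγ1 hR b
  have hV := Vmax_pos hγ1 hR
  rcases eq_or_ne c c' with rfl | hc
  · simp [sqNorm]
  have hup : sqNorm (M.occ π t) (choiceQ γ Rmax c - choiceQ γ Rmax c') ≤ Vmax γ Rmax ^ 2 := by
    calc sqNorm (M.occ π t) (choiceQ γ Rmax c - choiceQ γ Rmax c')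
        ≤ ∑ x, M.occ π t x * Vmax γ Rmax ^ 2 := by
          refine Finset.sum_le_sum fun x _ =>
            mul_le_mul_of_nonneg_left (sq_le_sq' ?_ ?_) (occ_nonneg M π t x) <;>
          · have := choiceQ_mem_Icc hγ0 hγ1 hR c x
            have := choiceQ_mem_Icc hγ0 hγ1 hR c' x
            simp only [Pi.sub_apply]
            linarith
      _ = Vmax γ Rmax ^ 2 := by rw [← Finset.sum_mul, sum_occ, one_mul]
  have hlow : (γ * Vmax γ Rmax) ^ 2 / 2 ≤
      sqNorm (fun x => rareDist η h0 h1 x) (choiceQ γ Rmax c - choiceQ γ Rmax c') := by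
    have hinit : ∀ a, (choiceQ γ Rmax c - choiceQ γ Rmax c') (0, a) ^ 2 =
        (γ * Vmax γ Rmax) ^ 2 := by
      intro a
      simp only [Pi.sub_apply, choiceQ, if_true]
      have : a = c ∨ a = c' := by omega
      rcases this with rfl | rfl
      · simp [hc]
      · simp [hc.symm]
    rw [sqNorm, Fintype.sum_prod_type]
    calc (γ * Vmax γ Rmax) ^ 2 / 2 ≤ (1 - 4 * η) * (γ * Vmax γ Rmax) ^ 2 := by
          nlinarith [sq_nonneg (γ * Vmax γ Rmax)]
      _ = ∑ a : Fin 2, rareDist η h0 h1 (0, a) *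
            (choiceQ γ Rmax c - choiceQ γ Rmax c') (0, a) ^ 2 := by
          simp only [hinit, rareDist_apply, Fin.sum_univ_two, if_true]
          ring
      _ ≤ _ := Finset.single_le_sum (f := fun s => ∑ a : Fin 2, rareDist η h0 h1 (s, a) *
            (choiceQ γ Rmax c - choiceQ γ Rmax c') (s, a) ^ 2)
          (fun s _ => Finset.sum_nonneg fun a _ =>
            mul_nonneg ((rareDist η h0 h1).2.1 (s, a)) (sq_nonneg _)) (Finset.mem_univ 0)
  calc sqNorm (M.occ π t) (choiceQ γ Rmax c - choiceQ γ Rmax c') ≤ Vmax γ Rmax ^ 2 := hup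
    _ = 2 / γ ^ 2 * ((γ * Vmax γ Rmax) ^ 2 / 2) := by field_simp
    _ ≤ _ := mul_le_mul_of_nonneg_left hlow (by positivity)

/-! ### Data from the initial state -/

/-- The tuples recorded at the initial state. -/
def initialTuples : Set (Tuple (Fin 3) (Fin 2)) := {z | z.1.1 = 0}

/-- The datasets of `n` tuples that were all recorded at the initial state. -/
def initialData (n : ℕ) : Set (Fin n → Tuple (Fin 3) (Fin 2)) :=
  Set.univ.pi fun _ => initialTuples

theorem measurableSet_initialTuples : MeasurableSet initialTuples :=
  measurable_fst.fst (measurableSet_singleton 0)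

theorem measurableSet_initialData (n : ℕ) : MeasurableSet (initialData n) :=
  MeasurableSet.univ_pi fun _ => measurableSet_initialTuples

theorem tupleLaw_apply {S A : Type} [Fintype S] [Fintype A] [MeasurableSpace S]
    [MeasurableSpace A] (M : MDP S A γ Rmax) (μ : stdSimplex ℝ (S × A))
    {T : Set (Tuple S A)} (hT : MeasurableSet T) :
    M.tupleLaw μ T =
      ∑ x, ∑ s', ENNReal.ofReal (μ x * M.P x s') * T.indicator 1 (x, M.R x, s') := by
  simp [tupleLaw, Measure.dirac_apply' _ hT]

/-- Tuples from the initial state show neither which absorbing state pays nor any reward. -/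
theorem restrict_tupleLaw_eq (hγ0 : 0 < γ) (hγ1 : γ < 1) (hR : 0 < Rmax) (b c : Fin 2)
    (μ : stdSimplex ℝ (Fin 3 × Fin 2)) :
    ((choiceMDP hγ0 hγ1 hR b).tupleLaw μ).restrict initialTuples =
      ((choiceMDP hγ0 hγ1 hR c).tupleLaw μ).restrict initialTuples := by
  ext T hT
  rw [Measure.restrict_apply hT, Measure.restrict_apply hT,
    tupleLaw_apply _ _ (hT.inter measurableSet_initialTuples),
    tupleLaw_apply _ _ (hT.inter measurableSet_initialTuples)]
  refine Finset.sum_congr rfl fun x _ => Finset.sum_congr rfl fun s' _ => ?_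
  by_cases hx : x.1 = 0
  · simp [choiceMDP, hx, (Fin.succ_ne_zero _).symm]
  · simp [initialTuples, hx]

theorem restrict_dataLaw_eq (hγ0 : 0 < γ) (hγ1 : γ < 1) (hR : 0 < Rmax) (b c : Fin 2)
    (μ : stdSimplex ℝ (Fin 3 × Fin 2)) (n : ℕ) :
    ((choiceMDP hγ0 hγ1 hR b).dataLaw μ n).restrict (initialData n) =
      ((choiceMDP hγ0 hγ1 hR c).dataLaw μ n).restrict (initialData n) := by
  simp only [dataLaw, initialData, Measure.restrict_pi_pi, restrict_tupleLaw_eq hγ0 hγ1 hR b c]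

theorem tupleLaw_compl_initialTuples (M : MDP (Fin 3) (Fin 2) γ Rmax)
    (η : ℝ) (h0 : 0 < η) (h1 : η ≤ 1 / 8) :
    M.tupleLaw (rareDist η h0 h1) initialTuplesᶜ = ENNReal.ofReal (4 * η) := by
  have hs : ∀ x, ∑ s', ENNReal.ofReal (rareDist η h0 h1 x * M.P x s') =
      ENNReal.ofReal (rareDist η h0 h1 x) := by
    intro x
    have hnn : ∀ s' ∈ Finset.univ, 0 ≤ rareDist η h0 h1 x * M.P x s' := fun s' _ =>
      mul_nonneg ((rareDist η h0 h1).2.1 x) ((M.P x).2.1 s')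
    rw [← ENNReal.ofReal_sum_of_nonneg hnn, ← Finset.mul_sum, stdSimplex.sum_eq_one,
      mul_one]
  rw [tupleLaw_apply _ _ measurableSet_initialTuples.compl]
  have hi : ∀ (x : Fin 3 × Fin 2) (s' : Fin 3),
      (initialTuplesᶜ).indicator (1 : Tuple (Fin 3) (Fin 2) → ℝ≥0∞) (x, M.R x, s') =
        if x.1 = 0 then 0 else 1 := by
    intro x s'
    by_cases hx : x.1 = 0 <;> simp [initialTuples, hx]
  simp only [hi, ← Finset.sum_mul, hs]
  simp only [rareDist_apply]
  simp only [Fintype.sum_prod_type, Fin.sum_univ_succ, mul_ite, mul_zero, mul_one]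
  simp [ENNReal.ofReal_mul]
  ring

theorem dataLaw_compl_initialData_le (M : MDP (Fin 3) (Fin 2) γ Rmax)
    (η : ℝ) (h0 : 0 < η) (h1 : η ≤ 1 / 8) (n : ℕ) :
    M.dataLaw (rareDist η h0 h1) n (initialData n)ᶜ ≤ ENNReal.ofReal (n * (4 * η)) := by
  have hcover : (initialData n)ᶜ = ⋃ i : Fin n, Function.eval i ⁻¹' initialTuplesᶜ := by
    ext z
    simp [initialData]
  rw [hcover]
  refine (measure_iUnion_le _).trans ?_
  have hi : ∀ i : Fin n, M.dataLaw (rareDist η h0 h1) n (Function.eval i ⁻¹' initialTuplesᶜ) =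
      ENNReal.ofReal (4 * η) := by
    intro i
    rw [dataLaw, (measurePreserving_eval _ i).measure_preimage
      measurableSet_initialTuples.compl.nullMeasurableSet, tupleLaw_compl_initialTuples]
  simp only [hi, tsum_fintype, Finset.sum_const, Finset.card_univ, Fintype.card_fin, nsmul_eq_mul]
  rw [ENNReal.ofReal_mul n.cast_nonneg, ENNReal.ofReal_natCast]

/-! ### The lower bound -/

theorem measurableSet_half_lt (s : Fin 3) (a : Fin 2) :
    MeasurableSet {π : Policy (Fin 3) (Fin 2) | 1 / 2 < π 0 s a} := by
  have h : Measurable fun π : Policy (Fin 3) (Fin 2) => (π 0 s : Fin 2 → ℝ) a :=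
    (measurable_pi_apply a).comp (measurable_subtype_coe.comp
      ((measurable_pi_apply s).comp (measurable_pi_apply 0)))
  exact measurableSet_lt measurable_const h

/-- The constants `2 / γ²` and `γ / 4` depend on neither `δ` nor `n`; only the data distribution is
adapted to them. -/
theorem not_succeeds (hγ0 : 0 < γ) (hγ1 : γ < 1) (hR : 0 < Rmax) {δ : ℝ} (hδ : δ < 1 / 2)
    {n : ℕ} (L : Learner (Fin 3) (Fin 2) n) :
    ¬ L.Succeeds γ Rmax (Set.range (choiceQ γ Rmax)) (2 / γ ^ 2) (γ / 4) δ := by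
  intro hL
  have := L.isMarkov
  -- Twice the union bound `4 n η` has to stay below the gap `1 - 2 δ`.
  obtain ⟨η, h0, h1, hη⟩ : ∃ η : ℝ, 0 < η ∧ η ≤ 1 / 8 ∧ 8 * n * η < 1 - 2 * δ := by
    have hgap : 0 < 1 - 2 * δ := by linarith
    have hn : (0 : ℝ) < 8 * (n + 1) := by positivity
    refine ⟨min (1 / 8) ((1 - 2 * δ) / (8 * (n + 1))), by positivity, min_le_left _ _, ?_⟩
    have hle := min_le_right (1 / 8) ((1 - 2 * δ) / (8 * (n + 1)))
    rw [le_div_iff₀ hn] at hle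
    have hpos : 0 < min (1 / 8) ((1 - 2 * δ) / (8 * (n + 1))) := by positivity
    linarith
  set μ := rareDist η h0 h1
  set M := choiceMDP hγ0 hγ1 hR
  have hμ : ∀ x, 0 < μ x := by
    intro x
    simp only [μ, rareDist_apply]
    split_ifs <;> linarith
  have hsucc : ∀ b, ENNReal.ofReal (1 - δ) ≤
      ((M b).dataLaw μ n).bind L.rule {π | (M b).NearOptimal (γ / 4) π} := fun b =>
    hL (M b) μ hμ ⟨b, (Qstar_choiceMDP hγ0 hγ1 hR b).symm⟩
      (choiceMDP_fAwareConc hγ0 hγ1 hR b η h0 h1)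
  have hprob : ∀ b, IsProbabilityMeasure ((M b).dataLaw μ n) := fun b => by
    unfold dataLaw
    infer_instance
  have hsep : {π | (M 1).NearOptimal (γ / 4) π} ⊆
      {π : Policy (Fin 3) (Fin 2) | 1 / 2 < π 0 0 0}ᶜ := by
    intro π hπ hπ'
    have hone : π 0 0 0 + π 0 0 1 = 1 := stdSimplex.add_eq_one (π 0 0)
    have := half_lt_of_nearOptimal hγ0 hγ1 hR hπ
    simp only [Set.mem_ofPred_eq] at hπ'
    linarith
  have htwo := bind_add_bind_le ((M 0).dataLaw μ n) ((M 1).dataLaw μ n) L.rule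
    (measurableSet_initialData n) (restrict_dataLaw_eq hγ0 hγ1 hR 0 1 μ n)
    (measurableSet_half_lt 0 0) (fun π hπ => half_lt_of_nearOptimal hγ0 hγ1 hR hπ) hsep
  have hall := ((add_le_add (hsucc 0) (hsucc 1)).trans htwo).trans
    (add_le_add_right (add_le_add (dataLaw_compl_initialData_le (M 0) η h0 h1 n)
      (dataLaw_compl_initialData_le (M 1) η h0 h1 n)) 1)
  have hn : 0 ≤ n * (4 * η) := by positivity
  rw [← ENNReal.ofReal_one, ← ENNReal.ofReal_add (by linarith) (by linarith),
    ← ENNReal.ofReal_add hn hn, ← ENNReal.ofReal_add zero_le_one (by linarith),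
    ENNReal.ofReal_le_ofReal_iff (by linarith)] at hall
  linarith

end

end BatchRL

theorem mainTheorem12 (γ Rmax : ℝ) (hγ0 : 0 < γ) (hγ1 : γ < 1) (hR : 0 < Rmax) :
    ∃ (k m : ℕ) (F : Set (Fin (k + 1) × Fin (m + 1) → ℝ)) (C ε : ℝ),
      F.Finite ∧ (∀ f ∈ F, ∀ x, 0 ≤ f x ∧ f x ≤ BatchRL.Vmax γ Rmax) ∧ 0 < C ∧ 0 < ε ∧
      ∀ δ : ℝ, 0 < δ → δ < 1 / 2 → ∀ n : ℕ,
        ¬ ∃ L : BatchRL.Learner (Fin (k + 1)) (Fin (m + 1)) n,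
          L.Succeeds γ Rmax F C ε δ := by
  refine ⟨2, 1, Set.range (BatchRL.choiceQ γ Rmax), 2 / γ ^ 2, γ / 4, Set.finite_range _, ?_,
    by positivity, by positivity, ?_⟩
  · rintro _ ⟨b, rfl⟩ x
    exact BatchRL.choiceQ_mem_Icc hγ0 hγ1 hR b x
  · rintro δ - hδ n ⟨L, hL⟩
    exact BatchRL.not_succeeds hγ0 hγ1 hR hδ L hL
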